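/- Let $X$ be a proper, geodesically complete $\mathrm{CAT}(0)$ space. A geodesic in $X$ is an isometric embedding $v\colon\mathbb{R}\to X$; the set $GX$ of all geodesics carries the topology of uniform convergence on compact sets. Geodesics $v,w$ are parallel if $t\mapsto d(v(t),w(t))$ is constant, and the parallel set $P^X_v=P_v\subseteq X$ is the union of the images of all geodesics in $X$ parallel to $v$. The cross section $C_v$ is the set of points of $P_v$ whose nearest point on $v(\mathbb{R})$ is $v(0)$; thus $P_v$ splits isometrically as $C_v\times v$ by $x\mapsto(\pi_{C_v}(x),\pi_v(x))$, where $\pi$ denotes nearest-point projection. \textbf{Decomposition Lemma.} Let $v\in GX$. Assume that $C_v$ contains a geodesic $u$ with $u(0)=v(0)$. Assume further that there is a sequence $v_n\to v$ in $GX$ of geodesics contained in the flat $u\times v\subseteq C_v\times v=P_v$, with no $v_n$ parallel to $v$ (for example $v_n(0)=v(0)$ and $v_n\neq v$), such that for every $x\in C_v$ there is a sequence $x_n\to x$ in $X$ with $x_n\in C_{v_n}$ for every $n$. Then $C_v=P^{C_v}_u$, the parallel set of $u$ in the metric space $C_v$. Hence $C_v=E\times u$ for some proper $\mathrm{CAT}(0)$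 space $E$; that is, there are a point $e\in E$ and an isometry of $C_v$ onto the $\ell^2$-product $E\times\mathbb{R}$ that maps $u(t)$ to $(e,t)$ for all $t\in\mathbb{R}$. -/

import Mathlib

open Filter Topology Set

universe uX

/-- A geodesic in `X`: an isometric embedding `ℝ → X`. -/
def Geodesic (X : Type*) [MetricSpace X] : Type _ := {v : C(ℝ, X) // Isometry v}

namespace Geodesic

variable {X : Type*} [MetricSpace X]

instance : CoeFun (Geodesic X) (fun _ => ℝ → X) := ⟨fun v => v.1⟩

/-- The space `GX` of geodesics carries the compact-open topology. -/
instance : TopologicalSpace (Geodesic X) :=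
  inferInstanceAs (TopologicalSpace {v : C(ℝ, X) // Isometry v})

/-- Two geodesics are parallel if `t ↦ d(v(t), w(t))` is constant. -/
def Parallel (v w : Geodesic X) : Prop := ∃ c : ℝ, ∀ t : ℝ, dist (v t) (w t) = c

/-- The parallel set `P_v` in `X`: all points that lie on some geodesic parallel to `v`. -/
def parallelSet (v : Geodesic X) : Set X := {x | ∃ w : Geodesic X, v.Parallel w ∧ x ∈ range w}

end Geodesic

/-- `y` is a nearest point of `S` to `x`; for `S` closed and convex in a complete CAT(0) space
this says that `y` is the convex projection of `x` to `S`. -/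
def IsProjection {X : Type*} [MetricSpace X] (S : Set X) (x y : X) : Prop :=
  y ∈ S ∧ ∀ z ∈ S, dist x y ≤ dist x z

namespace Geodesic

variable {X : Type*} [MetricSpace X]

/-- The cross section `C_v` of `v` in `X`: the points of `P_v` that project to `v(0)` on `v`. This
is the factor through `v(0)` of the splitting `P_v = C_v × v`. -/
def crossSection (v : Geodesic X) : Set X := {x ∈ v.parallelSet | IsProjection (range v) x (v 0)}

/-- For `S ⊆ C_v`, the subset `S × v` of `P_v = C_v × v`: the points `x` of `P_v` whose coordinates
`(π_{C_v}(x), π_v(x)) = (y, v(a))` have `y ∈ S`. -/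
def prodSet (v : Geodesic X) (S : Set X) : Set X :=
  {x ∈ v.parallelSet | ∃ y ∈ S, ∃ a : ℝ,
    IsProjection v.crossSection x y ∧ IsProjection (range v) x (v a)}

end Geodesic

/-- `σ`, restricted to `[0, r]`, is an isometric embedding. -/
def IsometricOnIcc {X : Type*} [MetricSpace X] (σ : ℝ → X) (r : ℝ) : Prop :=
  ∀ s ∈ Icc 0 r, ∀ t ∈ Icc 0 r, dist (σ s) (σ t) = dist s t

/-- `σ`, restricted to `[0, d(x, y)]`, is a geodesic segment from `x` to `y`. -/
def IsGeodesicSegment {X : Type*} [MetricSpace X] (σ : ℝ → X) (x y : X) : Prop :=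
  IsometricOnIcc σ (dist x y) ∧ σ 0 = x ∧ σ (dist x y) = y

/-- Every geodesic segment extends to a geodesic. -/
def GeodesicallyComplete (X : Type*) [MetricSpace X] : Prop :=
  ∀ (r : ℝ) (σ : ℝ → X), 0 < r → IsometricOnIcc σ r →
    ∃ v : Geodesic X, EqOn v σ (Icc 0 r)

/-- A CAT(0) space: uniquely geodesic, and geodesic triangles are no fatter than their comparison
triangles in the Euclidean plane. Two sides of a triangle always share a vertex, which is called
`x` below. -/
structure IsCAT0 (X : Type*) [MetricSpace X] : Prop where
  exists_segment : ∀ x y : X, ∃ σ : ℝ → X, IsGeodesicSegment σ x y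
  unique_segment : ∀ (x y : X) (σ τ : ℝ → X), IsGeodesicSegment σ x y → IsGeodesicSegment τ x y →
    EqOn σ τ (Icc 0 (dist x y))
  comparison : ∀ (x y z : X) (σ τ : ℝ → X), IsGeodesicSegment σ x y → IsGeodesicSegment τ x z →
    ∀ x' y' z' : EuclideanSpace ℝ (Fin 2),
      dist x' y' = dist x y → dist y' z' = dist y z → dist x' z' = dist x z →
      ∀ s ∈ Icc (0 : ℝ) 1, ∀ t ∈ Icc (0 : ℝ) 1,
        dist (σ (s * dist x y)) (τ (t * dist x z)) ≤
          dist (AffineMap.lineMap x' y' s) (AffineMap.lineMap x' z' t)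

/-! For x in C_v, the function s ↦ d(x, u(s))² - s² is midpoint convex by Bruhat–Tits. The point is
the opposite inequality (`dist_sq_add_dist_sq_le`): the function is then affine, so completing the
square gives d(x, u(s))² ≤ (s - p)² + D for some p and D. Such a bound yields a parallel to u
through x, by gluing rays from x asymptotic to the two ends of u.

For the opposite inequality, write the flat as F(s, t), with v vertical and v_n of direction (b_n,
d_n) → (0, 1), where b_n ≠ 0 for large n. By Pythagoras, squared distances from x along verticals,
and from x_n along lines parallel to v_n, are known up to their value at the foot. A vertical and a
tilted line meet at some height h, possibly huge. Comparing x with x_n along the horizontal segment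
from F(s, h) to F(s + T, h) cancels h² and links d(x, u(s ± T)) with d(x, u(s)). The comparison
error is bounded independently of h (`dist_sq_sub_le`), which is why unbounded h is harmless.

Once C_v is known to be a proper CAT(0) space, the product statement is the splitting of a parallel
set applied inside C_v. -/

/-! ### Preliminaries on the Euclidean plane and on real functions. -/

theorem exists_comparison_triangle {a b c : ℝ} (ha : 0 ≤ a) (hb : 0 ≤ b) (hc : 0 ≤ c)
    (hab : c ≤ a + b) (hbc : a ≤ b + c) (hca : b ≤ c + a) :
    ∃ x y z : EuclideanSpace ℝ (Fin 2), dist x y = a ∧ dist y z = b ∧ dist x z = c := by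
  rcases ha.eq_or_lt with rfl | ha
  · have : b = c := by linarith
    subst this
    exact ⟨!₂[0, 0], !₂[0, 0], !₂[b, 0], by simp, by simp [EuclideanSpace.dist_eq, Real.sqrt_sq hb],
      by simp [EuclideanSpace.dist_eq, Real.sqrt_sq hb]⟩
  -- By the law of cosines, p is the foot of the third vertex on the side of length a.
  · set p := (a ^ 2 + c ^ 2 - b ^ 2) / (2 * a) with hp
    have hpa : 2 * a * p = a ^ 2 + c ^ 2 - b ^ 2 := by rw [hp]; field_simp
    have hq : 0 ≤ c ^ 2 - p ^ 2 := by
      have h1 : -c ≤ p := by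
        rw [hp, le_div_iff₀ (by positivity)]; nlinarith
      have h2 : p ≤ c := by
        rw [hp, div_le_iff₀ (by positivity)]; nlinarith
      nlinarith
    have hs := Real.sq_sqrt hq
    refine ⟨!₂[0, 0], !₂[a, 0], !₂[p, √(c ^ 2 - p ^ 2)], ?_, ?_, ?_⟩
    · simp [EuclideanSpace.dist_eq, Real.sqrt_sq ha.le]
    · simp only [EuclideanSpace.dist_eq, Fin.sum_univ_two, Real.dist_eq, sq_abs]
      simp only [Matrix.cons_val_zero, Matrix.cons_val_one, Matrix.cons_val_fin_one]
      rw [Real.sqrt_eq_iff_eq_sq (by positivity) hb]; linarith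
    · simp only [EuclideanSpace.dist_eq, Fin.sum_univ_two, Real.dist_eq, sq_abs]
      simp only [Matrix.cons_val_zero, Matrix.cons_val_one, Matrix.cons_val_fin_one]
      rw [Real.sqrt_eq_iff_eq_sq (by positivity) hc]; linarith

theorem dist_lineMap_sq {V : Type*} [NormedAddCommGroup V] [InnerProductSpace ℝ V]
    (x y z : V) (s : ℝ) :
    dist (AffineMap.lineMap x y s) z ^ 2 =
      (1 - s) * dist x z ^ 2 + s * dist y z ^ 2 - s * (1 - s) * dist x y ^ 2 := by
  have e1 : (AffineMap.lineMap x y s : V) - z = (1 - s) • (x - z) + s • (y - z) := by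
    simp only [AffineMap.lineMap_apply_module]; module
  have e2 : ‖x - y‖ ^ 2 = ‖x - z‖ ^ 2 - 2 * inner ℝ (x - z) (y - z) + ‖y - z‖ ^ 2 := by
    rw [← norm_sub_sq_real, sub_sub_sub_cancel_right]
  rw [dist_eq_norm, dist_eq_norm, dist_eq_norm, dist_eq_norm, e1, e2, norm_add_sq_real,
    norm_smul, norm_smul, inner_smul_left, inner_smul_right, mul_pow, mul_pow]
  simp only [Real.norm_eq_abs, sq_abs, conj_trivial]
  ring

theorem eq_linear_of_midpoint_affine {f : ℝ → ℝ} (hf : Continuous f)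
    (h : ∀ x r, f (x + r) + f (x - r) = 2 * f x) : ∃ k, ∀ x, f x = k * x + f 0 := by
  let g : ℝ →+ ℝ := 
    { toFun := fun x => f x - f 0
      map_zero' := by simp
      map_add' := fun x y => by
        have h1 := h ((x + y) / 2) ((x + y) / 2)
        have h2 := h ((x + y) / 2) ((x - y) / 2)
        rw [show (x + y) / 2 + (x + y) / 2 = x + y by ring, sub_self] at h1
        rw [show (x + y) / 2 + (x - y) / 2 = x by ring,
          show (x + y) / 2 - (x - y) / 2 = y by ring] at h2
        linarith }
  have hg : Continuous g := hf.sub continuous_const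
  refine ⟨g 1, fun x => ?_⟩
  have := map_real_smul g hg x 1
  simp only [smul_eq_mul, mul_one] at this
  have h2 : g x = f x - f 0 := rfl
  linarith

/-- Along an arithmetic progression the increments never decrease, so one positive increment forces
f to be unbounded above. -/
theorem eq_of_midpoint_convex_of_bounded {f : ℝ → ℝ} {K : ℝ} (hK : ∀ x, f x ≤ K)
    (h : ∀ x r, 2 * f x ≤ f (x + r) + f (x - r)) (x y : ℝ) : f x = f y := by
  have key : ∀ x y, f y ≤ f x := by
    intro x y
    by_contra! hlt
    have step : ∀ n : ℕ, f y + n * (f y - f x) ≤ f (y + n * (y - x)) ∧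
        f y - f x ≤ f (y + n * (y - x)) - f (y + n * (y - x) - (y - x)) := by
      intro n
      induction n with
      | zero => simp
      | succ n ih =>
        have := h (y + n * (y - x)) (y - x)
        push_cast
        rw [show y + ((n : ℝ) + 1) * (y - x) = y + n * (y - x) + (y - x) by ring]
        rw [add_sub_cancel_right]
        constructor <;> linarith [ih.1, ih.2]
    obtain ⟨n, hn⟩ := exists_nat_gt ((K - f y) / (f y - f x))
    rw [div_lt_iff₀ (by linarith)] at hn
    linarith [(step n).1, hK (y + n * (y - x))]
  exact le_antisymm (key _ _) (key _ _)

/-- The inequality of Bruhat and Tits. -/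
theorem IsCAT0.dist_sq_le {X : Type*} [MetricSpace X] (hX : IsCAT0 X) {x y : X} {σ : ℝ → X}
    (hσ : IsGeodesicSegment σ x y) (z : X) {s : ℝ} (hs : s ∈ Icc (0 : ℝ) 1) :
    dist (σ (s * dist x y)) z ^ 2 ≤
      (1 - s) * dist x z ^ 2 + s * dist y z ^ 2 - s * (1 - s) * dist x y ^ 2 := by
  obtain ⟨τ, hτ⟩ := hX.exists_segment x z
  obtain ⟨x', y', z', h1, h2, h3⟩ := exists_comparison_triangle (a := dist x y) (b := dist y z)
    (c := dist x z) dist_nonneg dist_nonneg dist_nonneg (dist_triangle _ _ _)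
    (by rw [add_comm, dist_comm y z]; exact dist_triangle _ _ _)
    (by rw [add_comm, dist_comm x y]; exact dist_triangle _ _ _)
  have h := hX.comparison x y z σ τ hσ hτ x' y' z' h1 h2 h3 s hs 1 ⟨zero_le_one, le_rfl⟩
  rw [one_mul, hτ.2.2, AffineMap.lineMap_apply_one] at h
  rw [← h1, ← h2, ← h3, ← dist_lineMap_sq, h1]
  gcongr

/-! ### Reparametrized geodesics. -/

namespace Geodesic

variable {X : Type*} [MetricSpace X]

/-- The geodesic with a given underlying isometric embedding. -/
def ofIsometry (f : ℝ → X) (hf : Isometry f) : Geodesic X := ⟨⟨f, hf.continuous⟩, hf⟩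

@[simp] theorem ofIsometry_apply (f : ℝ → X) (hf : Isometry f) (t : ℝ) :
    ofIsometry f hf t = f t := rfl

theorem dist_apply (v : Geodesic X) (s t : ℝ) : dist (v s) (v t) = |s - t| := by
  rw [← Real.dist_eq]; exact v.2.dist_eq s t

theorem continuous (v : Geodesic X) : Continuous v := v.2.continuous

/-- The geodesic `t ↦ v (t + a)`. -/
def shift (v : Geodesic X) (a : ℝ) : Geodesic X :=
  ofIsometry (fun t => v (t + a)) (Isometry.of_dist_eq fun s t => by
    rw [dist_apply, Real.dist_eq]; congr 1; ring)

@[simp] theorem shift_apply (v : Geodesic X) (a t : ℝ) : v.shift a t = v (t + a) := rfl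

/-- The geodesic `t ↦ v (-t)`. -/
def reverse (v : Geodesic X) : Geodesic X :=
  ofIsometry (fun t => v (-t)) (Isometry.of_dist_eq fun s t => by
    rw [dist_apply, Real.dist_eq, abs_sub_comm]; congr 1; ring)

@[simp] theorem reverse_apply (v : Geodesic X) (t : ℝ) : v.reverse t = v (-t) := rfl

theorem isGeodesicSegment (v : Geodesic X) (s : ℝ) {r : ℝ} (hr : 0 ≤ r) :
    IsGeodesicSegment (fun t => v (s + t)) (v s) (v (s + r)) := by
  refine ⟨fun a _ b _ => ?_, by simp, ?_⟩
  · rw [dist_apply, Real.dist_eq]; congr 1; ring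
  · rw [dist_apply]; simp [abs_of_nonneg hr]

end Geodesic

/-! ### CAT(0) inequalities, flat strips and asymptotic rays. -/

namespace IsCAT0

variable {X : Type*} [MetricSpace X]

theorem two_mul_dist_sq_le (hX : IsCAT0 X) (v : Geodesic X) (z : X) (s r : ℝ) :
    2 * dist z (v s) ^ 2 + 2 * r ^ 2 ≤ dist z (v (s + r)) ^ 2 + dist z (v (s - r)) ^ 2 := by
  wlog hr : 0 ≤ r generalizing r
  · have := this (-r) (by linarith)
    rw [← sub_eq_add_neg, sub_neg_eq_add, neg_sq] at this
    linarith
  have h := hX.dist_sq_le (v.isGeodesicSegment (s - r) (r := 2 * r) (by linarith)) z (s := 1 / 2)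
    (by norm_num)
  rw [v.dist_apply] at h
  rw [show s - r - (s - r + 2 * r) = -(2 * r) by ring, abs_neg, abs_of_nonneg (by linarith : 0 ≤ 2 * r)] at h
  rw [show s - r + 1 / 2 * (2 * r) = s by ring, show s - r + 2 * r = s + r by ring] at h
  rw [dist_comm z, dist_comm z, dist_comm z]
  linarith

/-- Apply Bruhat–Tits at the midpoint m of ac to b and to d, then use d(b, d)² ≤ 2 d(m, b)² + 2 d(m,
d)². -/
theorem quadrilateral (hX : IsCAT0 X) (a b c d : X) :
    dist a c ^ 2 + dist b d ^ 2 ≤ dist a b ^ 2 + dist b c ^ 2 + dist c d ^ 2 + dist d a ^ 2 := by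
  obtain ⟨σ, hσ⟩ := hX.exists_segment a c
  have h1 := hX.dist_sq_le hσ b (s := 1 / 2) (by norm_num)
  have h2 := hX.dist_sq_le hσ d (s := 1 / 2) (by norm_num)
  set m := σ (1 / 2 * dist a c)
  have h3 : dist b d ≤ dist m b + dist m d := by
    rw [dist_comm m b]; exact dist_triangle _ _ _
  have h4 : dist b d ^ 2 ≤ (dist m b + dist m d) ^ 2 := by gcongr
  rw [dist_comm b c, dist_comm d a]
  nlinarith [sq_nonneg (dist m b - dist m d)]

/-- The flat strip theorem, in coordinates. -/
theorem flat_strip (hX : IsCAT0 X) (v w : Geodesic X) {K : ℝ} (hK : ∀ t, dist (v t) (w t) ≤ K) :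
    ∃ a c : ℝ, ∀ s t, dist (v s) (w t) ^ 2 = (s - t + a) ^ 2 + c := by
  -- At a fixed parameter offset r, the squared distance is midpoint convex and bounded, hence
  -- constant.
  have hdiag : ∀ r s t, dist (v (s + r)) (w s) ^ 2 = dist (v (t + r)) (w t) ^ 2 := by
    intro r
    refine eq_of_midpoint_convex_of_bounded (f := fun t => dist (v (t + r)) (w t) ^ 2)
      (K := (|r| + K) ^ 2) (fun t => ?_) (fun t e => ?_)
    · have h1 : dist (v (t + r)) (w t) ≤ |r| + K := by
        refine (dist_triangle _ (v t) _).trans (add_le_add ?_ (hK t))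
        rw [v.dist_apply]; simp
      gcongr
    · have h1 := hX.two_mul_dist_sq_le v (w t) (t + r) e
      have h2 := hX.two_mul_dist_sq_le w (v (t + r + e)) t e
      have h3 := hX.two_mul_dist_sq_le w (v (t + r - e)) t e
      have h5 := hX.quadrilateral (v (t + r + e)) (v (t + r - e)) (w (t - e)) (w (t + e))
      rw [v.dist_apply, w.dist_apply, sq_abs, sq_abs, dist_comm (w (t + e))] at h5
      rw [dist_comm (w t), dist_comm (w t), dist_comm (w t)] at h1
      rw [show t + e + r = t + r + e by ring, show t - e + r = t + r - e by ring]
      linarith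
  have hf : ∀ s t, dist (v s) (w t) ^ 2 = dist (v (s - t)) (w 0) ^ 2 := fun s t => by
    have := hdiag (s - t) t 0
    rwa [add_sub_cancel, zero_add] at this
  -- Bruhat–Tits gives convexity; the quadrilateral inequality, with `hdiag`, gives concavity.
  obtain ⟨k, hk⟩ := eq_linear_of_midpoint_affine (f := fun r => dist (v r) (w 0) ^ 2 - r ^ 2)
    (by have := v.continuous; fun_prop) (fun x r => by
      have h1 := hX.two_mul_dist_sq_le v (w 0) x r
      have h3 := hX.quadrilateral (v x) (v (x + r)) (w r) (w 0)
      have e1 := hf x r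
      have e2 := hf (x + r) r
      rw [add_sub_cancel_right] at e2
      rw [v.dist_apply, w.dist_apply, sq_abs, sq_abs, dist_comm (w 0), e1, e2] at h3
      rw [dist_comm (w 0), dist_comm (w 0), dist_comm (w 0)] at h1
      linarith)
  refine ⟨k / 2, dist (v 0) (w 0) ^ 2 - (k / 2) ^ 2, fun s t => ?_⟩
  have := hk (s - t)
  beta_reduce at this
  rw [hf]
  linarith

/-- Points with Busemann coordinates `p` and `q` along `v` are at distance at least `p - q`. -/
theorem sub_le_dist (v : Geodesic X) {x y : X} {p q D D' : ℝ}
    (hx : ∀ t, dist x (v t) ^ 2 ≤ (t - p) ^ 2 + D)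
    (hy : ∀ t, dist y (v t) ^ 2 ≤ (t - q) ^ 2 + D') : p - q ≤ dist x y := by
  refine le_of_forall_pos_le_add fun ε hε => ?_
  -- Large enough that the square-root corrections due to D and D' are each at most ε/2.
  set T := |p| + |q| + (|D| + |D'|) / ε
  have hT : ε * (T - |p| - |q|) = |D| + |D'| := by
    simp only [T]; field_simp; ring
  have hT0 : |p| + |q| ≤ T := by simp only [T]; linarith [show 0 ≤ (|D| + |D'|) / ε by positivity]
  have h1 : dist x (v T) ≤ T - p + ε / 2 := by
    refine abs_le_of_sq_le_sq' ?_ (by linarith [le_abs_self p, abs_nonneg q]) |>.2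
    nlinarith [hx T, le_abs_self p, abs_nonneg q, le_abs_self D, abs_nonneg D']
  have h2 : dist y (v (-T)) ≤ T + q + ε / 2 := by
    refine abs_le_of_sq_le_sq' ?_ (by linarith [neg_abs_le q, abs_nonneg p]) |>.2
    nlinarith [hy (-T), neg_abs_le q, abs_nonneg p, le_abs_self D', abs_nonneg D]
  have h3 : dist (v T) (v (-T)) = 2 * T := by
    rw [v.dist_apply, sub_neg_eq_add, ← two_mul,
      abs_of_nonneg (by linarith [abs_nonneg p, abs_nonneg q])]
  have h4 := dist_triangle4 (v T) x y (v (-T))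
  rw [dist_comm (v T) x] at h4
  linarith

/-- The ray is an ultralimit of the segments from x to v(n); the distance bound is Bruhat–Tits on
those segments in the limit. -/
theorem exists_ray [ProperSpace X] (hX : IsCAT0 X) (v : Geodesic X) {x : X} {D : ℝ}
    (hx : ∀ t, dist x (v t) ^ 2 ≤ t ^ 2 + D) :
    ∃ ρ : ℝ → X, ρ 0 = x ∧ (∀ s t, 0 ≤ s → 0 ≤ t → dist (ρ s) (ρ t) = |s - t|) ∧
      ∀ s t, 0 ≤ s → dist (ρ s) (v t) ^ 2 ≤ (t - s) ^ 2 + D := by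
  have hD : 0 ≤ D := by have := hx 0; nlinarith [sq_nonneg (dist x (v 0))]
  choose σ hσ using fun n : ℕ => hX.exists_segment x (v n)
  set l : ℕ → ℝ := fun n => dist x (v n) with hl
  -- The hypothesis only bounds l n above; the lower bound comes from the triangle inequality
  -- through v(-n).
  have he : Tendsto (fun n : ℕ => (n : ℝ) - l n) atTop (𝓝 0) := by
    have h0 : Tendsto (fun n : ℕ => D / (n : ℝ)) atTop (𝓝 0) := tendsto_const_div_atTop_nhds_zero_nat D
    refine squeeze_zero_norm' ?_ h0
    filter_upwards [eventually_gt_atTop 0] with n hn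
    have hn' : (0 : ℝ) < n := by exact_mod_cast hn
    have hq : (n : ℝ) * (D / n) = D := by field_simp
    have hp : 0 ≤ D / (n : ℝ) := by positivity
    have h1 : l n ≤ n + D / n :=
      abs_le_of_sq_le_sq' (by nlinarith [hx n]) (by positivity) |>.2
    have h2 : dist x (v (-n)) ≤ n + D / n :=
      abs_le_of_sq_le_sq' (by nlinarith [hx (-n)]) (by positivity) |>.2
    have h3 := dist_triangle_left (v n) (v (-n)) x
    rw [v.dist_apply, sub_neg_eq_add, abs_of_nonneg (by positivity)] at h3
    rw [Real.norm_eq_abs, abs_le]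
    constructor <;> linarith
  have hltop : Tendsto l atTop atTop := by
    have : Tendsto (fun n : ℕ => (n : ℝ) + -((n : ℝ) - l n)) atTop atTop :=
      tendsto_natCast_atTop_atTop.atTop_add he.neg
    simpa using this
  set U : Ultrafilter ℕ := hyperfilter ℕ
  have hU : (U : Filter ℕ) ≤ atTop := by
    rw [← Nat.cofinite_eq_atTop]; exact hyperfilter_le_cofinite
  have hlim : ∀ s : ℝ, ∃ y, 0 ≤ s → Tendsto (fun n => σ n s) U (𝓝 y) := by
    intro s
    by_cases hs : 0 ≤ s
    · have : ∀ᶠ n in (U : Filter ℕ), σ n s ∈ Metric.closedBall x s := by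
        filter_upwards [hU (hltop.eventually_ge_atTop s)] with n hn
        have := (hσ n).1 s ⟨hs, hn⟩ 0 ⟨le_rfl, dist_nonneg⟩
        rw [(hσ n).2.1, Real.dist_eq, sub_zero, abs_of_nonneg hs] at this
        exact this.le
      obtain ⟨y, -, hy⟩ := (isCompact_closedBall x s).ultrafilter_le_nhds (U.map fun n => σ n s)
        (le_principal_iff.2 this)
      exact ⟨y, fun _ => hy⟩
    · exact ⟨x, fun h => absurd h hs⟩
  choose ρ hρ using hlim
  refine ⟨ρ, ?_, fun s t hs ht => ?_, fun s t hs => ?_⟩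
  · refine tendsto_nhds_unique (hρ 0 le_rfl) ?_
    simp only [fun n => (hσ n).2.1]
    exact tendsto_const_nhds
  · refine tendsto_nhds_unique ((hρ s hs).dist (hρ t ht)) (tendsto_const_nhds.congr' ?_)
    filter_upwards [hU (hltop.eventually_ge_atTop s), hU (hltop.eventually_ge_atTop t)] with n h1 h2
    rw [(hσ n).1 s ⟨hs, h1⟩ t ⟨ht, h2⟩, Real.dist_eq]
  · have hr : Tendsto (fun n : ℕ => t ^ 2 + D + s ^ 2 +
        s * (((n : ℝ) - l n - t) * (2 + ((n : ℝ) - l n - t) / l n))) atTop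
        (𝓝 (t ^ 2 + D + s ^ 2 + s * ((0 - t) * (2 + 0)))) :=
      (((he.sub_const t).mul (((he.sub_const t).div_atTop hltop).const_add 2)).const_mul s).const_add _
    have := le_of_tendsto_of_tendsto (((hρ s hs).dist tendsto_const_nhds).pow 2) (hr.mono_left hU)
      (b := (U : Filter ℕ)) (f := fun n => dist (σ n s) (v t) ^ 2) ?_
    · linarith
    filter_upwards [hU (hltop.eventually_ge_atTop s), hU (hltop.eventually_gt_atTop 0)] with n h1 h2
    have h := hX.dist_sq_le (hσ n) (v t) (s := s / l n)
      ⟨by positivity, (div_le_one h2).2 h1⟩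
    change dist (σ n (s / l n * l n)) (v t) ^ 2 ≤ _ at h
    rw [div_mul_cancel₀ _ h2.ne', v.dist_apply, sq_abs] at h
    refine h.trans ?_
    change (1 - s / l n) * dist x (v t) ^ 2 + s / l n * (n - t) ^ 2 -
      s / l n * (1 - s / l n) * l n ^ 2 ≤ _
    have h3 : s / l n * (n - t) ^ 2 - s / l n * (1 - s / l n) * l n ^ 2 =
        s ^ 2 + s * (((n : ℝ) - l n - t) * (2 + ((n : ℝ) - l n - t) / l n)) := by
      field_simp; ring
    have h4 : (1 - s / l n) * dist x (v t) ^ 2 ≤ 1 * (t ^ 2 + D) := by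
      have : 0 ≤ s / l n := by positivity
      have : s / l n ≤ 1 := (div_le_one h2).2 h1
      apply mul_le_mul (by linarith) (hx t) (by positivity) zero_le_one
    linarith

end IsCAT0

open Geodesic

/-! ### Parallel sets, cross sections and their splitting. -/

namespace IsCAT0

variable {X : Type*} [MetricSpace X]

/-- A nonzero flat-strip offset a would produce an unbounded linear term 2a(s - t), which D cannot
absorb. -/
theorem parallel_of_dist_sq (hX : IsCAT0 X) {v w : Geodesic X} {D : ℝ}
    (h : ∀ s t, dist (w s) (v t) ^ 2 ≤ (t - s) ^ 2 + D) :
    v.Parallel w ∧ ∀ s t, dist (w s) (v t) ^ 2 = (s - t) ^ 2 + dist (w 0) (v 0) ^ 2 := by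
  have hK : ∀ t, dist (w t) (v t) ≤ √D := fun t =>
    Real.le_sqrt_of_sq_le (by simpa using h t t)
  obtain ⟨a, c, hac⟩ := hX.flat_strip w v hK
  have ha : a = 0 := by
    by_contra ha
    have h1 := h ((D + 1 - c) / (2 * a)) 0
    rw [hac] at h1
    have : 2 * a * ((D + 1 - c) / (2 * a)) = D + 1 - c := by field_simp
    nlinarith [sq_nonneg a]
  subst ha
  have h0 := hac 0 0
  have h' : ∀ s t, dist (w s) (v t) ^ 2 = (s - t) ^ 2 + dist (w 0) (v 0) ^ 2 := fun s t => by
    rw [hac s t, h0]; ring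
  refine ⟨⟨dist (w 0) (v 0), fun t => ?_⟩, h'⟩
  have := h' t t
  rw [sub_self, zero_pow two_ne_zero, zero_add, sq_eq_sq₀ dist_nonneg dist_nonneg] at this
  rw [dist_comm, this]

theorem exists_line_of_dist_sq_le [ProperSpace X] (hX : IsCAT0 X) (v : Geodesic X) {x : X} {D : ℝ}
    (hx : ∀ t, dist x (v t) ^ 2 ≤ t ^ 2 + D) :
    ∃ w : Geodesic X, w 0 = x ∧ v.Parallel w ∧
      ∀ s t, dist (w s) (v t) ^ 2 = (s - t) ^ 2 + dist x (v 0) ^ 2 := by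
  obtain ⟨ρ, h0, hd, hb⟩ := hX.exists_ray v hx
  obtain ⟨ρ', h0', hd', hb'⟩ := hX.exists_ray v.reverse (x := x) (D := D) fun t => by
    simpa using hx (-t)
  set f : ℝ → X := fun t => if 0 ≤ t then ρ t else ρ' (-t) with hf
  have hfb : ∀ s t, dist (f s) (v t) ^ 2 ≤ (t - s) ^ 2 + D := by
    intro s t
    simp only [hf]
    split_ifs with hs
    · exact hb s t hs
    · have := hb' (-s) (-t) (by linarith)
      rw [reverse_apply, neg_neg] at this
      linarith
  -- The broken path through x is geodesic: the Busemann coordinates s and t of its endpoints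
  -- already force distance s - t.
  have hmix : ∀ s t, 0 ≤ s → t < 0 → dist (f s) (f t) = s - t := by
    intro s t hs ht
    refine le_antisymm ?_ (sub_le_dist v (hfb s) (hfb t))
    refine (dist_triangle _ x _).trans ?_
    simp only [hf, if_pos hs, if_neg ht.not_ge]
    have e1 := hd s 0 hs le_rfl
    have e2 := hd' 0 (-t) le_rfl (by linarith)
    rw [h0, sub_zero, abs_of_nonneg hs] at e1
    rw [h0', zero_sub, neg_neg, abs_of_neg ht] at e2
    linarith
  have hiso : Isometry f := Isometry.of_dist_eq fun s t => by
    rw [Real.dist_eq]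
    rcases le_or_gt 0 s with hs | hs <;> rcases le_or_gt 0 t with ht | ht
    · simp only [hf, if_pos hs, if_pos ht, hd s t hs ht]
    · rw [hmix s t hs ht, abs_of_nonneg (by linarith)]
    · rw [dist_comm, hmix t s ht hs, abs_of_nonpos (by linarith), neg_sub]
    · simp only [hf, if_neg hs.not_ge, if_neg ht.not_ge,
        hd' (-s) (-t) (by linarith) (by linarith)]
      rw [abs_sub_comm]; congr 1; ring
  have hw0 : ofIsometry f hiso 0 = x := by simp [hf, h0]
  obtain ⟨h1, h2⟩ := hX.parallel_of_dist_sq (v := v) (w := ofIsometry f hiso) hfb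
  rw [hw0] at h2
  exact ⟨_, hw0, h1, h2⟩

theorem mem_parallelSet_of_dist_sq_le [ProperSpace X] (hX : IsCAT0 X) {v : Geodesic X} {x : X}
    {a D : ℝ} (hx : ∀ t, dist x (v t) ^ 2 ≤ (t - a) ^ 2 + D) : x ∈ v.parallelSet := by
  obtain ⟨w, h0, ⟨c, hc⟩, -⟩ := hX.exists_line_of_dist_sq_le (v.shift a) (x := x) (D := D) fun t => by
    simpa using hx (t + a)
  refine ⟨w.shift (-a), ⟨c, fun t => ?_⟩, a, by simpa using h0⟩
  have := hc (t + -a)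
  rwa [shift_apply, neg_add_cancel_right] at this

/-- In flat-strip coordinates the foot of x on v is the vertex of a parabola, and minimality puts it
at 0. With the converse below, this Pythagorean identity characterizes C_v. -/
theorem dist_sq_of_mem_crossSection (hX : IsCAT0 X) {v : Geodesic X} {x : X}
    (hx : x ∈ v.crossSection) (t : ℝ) : dist x (v t) ^ 2 = t ^ 2 + dist x (v 0) ^ 2 := by
  obtain ⟨⟨w, ⟨c, hc⟩, s, rfl⟩, -, hmin⟩ := hx
  obtain ⟨a, d, had⟩ := hX.flat_strip w v (K := c) fun t => by rw [dist_comm, hc]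
  have h := hmin (v (s + a)) ⟨_, rfl⟩
  rw [← sq_le_sq₀ dist_nonneg dist_nonneg, had, had] at h
  have : s + a = 0 := by nlinarith
  rw [had, had, show a = -s by linarith]
  ring

theorem mem_crossSection_of_dist_sq_le [ProperSpace X] (hX : IsCAT0 X) {v : Geodesic X} {x : X}
    {D : ℝ} (hx : ∀ t, dist x (v t) ^ 2 ≤ t ^ 2 + D) : x ∈ v.crossSection := by
  obtain ⟨w, h0, hp, hd⟩ := hX.exists_line_of_dist_sq_le v hx
  refine ⟨⟨w, hp, 0, h0⟩, ⟨0, rfl⟩, ?_⟩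
  rintro _ ⟨t, rfl⟩
  rw [← sq_le_sq₀ dist_nonneg dist_nonneg, ← h0, hd 0 t, h0]
  nlinarith [sq_nonneg (0 - t)]

theorem self_mem_crossSection [ProperSpace X] (hX : IsCAT0 X) (v : Geodesic X) :
    v 0 ∈ v.crossSection :=
  hX.mem_crossSection_of_dist_sq_le (D := 0) fun t => by simp [v.dist_apply]

theorem exists_parallel_of_mem_crossSection [ProperSpace X] (hX : IsCAT0 X) {v : Geodesic X} {x : X}
    (hx : x ∈ v.crossSection) : ∃ w : Geodesic X, w 0 = x ∧ v.Parallel w :=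
  let ⟨w, h0, hp, _⟩ := hX.exists_line_of_dist_sq_le v
    fun t => (hX.dist_sq_of_mem_crossSection hx t).le
  ⟨w, h0, hp⟩

/-- Every point of `P_v` lies on a geodesic parallel to `v` that starts in `C_v`. -/
theorem exists_parallel_of_mem_parallelSet [ProperSpace X] (hX : IsCAT0 X) {v : Geodesic X} {x : X}
    (hx : x ∈ v.parallelSet) :
    ∃ w : Geodesic X, w 0 ∈ v.crossSection ∧ v.Parallel w ∧ ∃ a, w a = x := by
  obtain ⟨w, ⟨c, hc⟩, s, rfl⟩ := hx
  obtain ⟨a, d, had⟩ := hX.flat_strip w v (K := c) fun t => by rw [dist_comm, hc]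
  have h : ∀ s t, dist (w.shift (-a) s) (v t) ^ 2 = (t - s) ^ 2 + d := fun s t => by
    rw [shift_apply, had]; ring
  refine ⟨w.shift (-a), ?_, (hX.parallel_of_dist_sq fun s t => (h s t).le).1, s + a, by simp⟩
  exact hX.mem_crossSection_of_dist_sq_le (D := d) fun t => by simpa using (h 0 t).le

/-- The splitting `P_v = C_v × v`. -/
theorem dist_sq_of_parallel (hX : IsCAT0 X) {v w w' : Geodesic X} (hw : v.Parallel w)
    (hw' : v.Parallel w') (h0 : w 0 ∈ v.crossSection) (h0' : w' 0 ∈ v.crossSection) (s t : ℝ) :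
    dist (w s) (w' t) ^ 2 = (s - t) ^ 2 + dist (w 0) (w' 0) ^ 2 := by
  have hb : ∀ w : Geodesic X, v.Parallel w → w 0 ∈ v.crossSection →
      ∃ D, ∀ s t, dist (w s) (v t) ^ 2 ≤ (t - s) ^ 2 + D := by
    rintro w ⟨c, hc⟩ h0
    obtain ⟨a, d, had⟩ := hX.flat_strip w v (K := c) fun t => by rw [dist_comm, hc]
    refine ⟨d, fun s t => ?_⟩
    have h1 := hX.dist_sq_of_mem_crossSection h0 1
    have h2 := hX.dist_sq_of_mem_crossSection h0 (-1)
    rw [had, had] at h1 h2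
    have : a = 0 := by linarith
    subst this
    rw [had]
    exact le_of_eq (by ring)
  obtain ⟨D, hD⟩ := hb w hw h0
  obtain ⟨D', hD'⟩ := hb w' hw' h0'
  obtain ⟨c, hc⟩ := hw
  obtain ⟨c', hc'⟩ := hw'
  obtain ⟨a, d, had⟩ := hX.flat_strip w w' (K := c + c') fun t => by
    rw [← hc t, ← hc' t]; exact dist_triangle_left _ _ _
  have ha : a = 0 := by
    by_contra ha
    -- Busemann coordinates along v bound both distances below by r; for large r one of the two
    -- contradicts a ≠ 0.
    have hr : ∀ r : ℝ, 0 ≤ r → r ^ 2 ≤ (r + a) ^ 2 + d ∧ r ^ 2 ≤ (-r + a) ^ 2 + d := by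
      intro r hr
      have h1 := sub_le_dist v (hD r) (hD' 0)
      have h2 := sub_le_dist v (hD' r) (hD 0)
      have h3 := had r 0
      have h4 := had 0 r
      rw [dist_comm] at h2
      rw [sub_zero] at h1 h2 h3
      rw [zero_sub] at h4
      constructor <;> [rw [← h3]; rw [← h4]] <;> gcongr
    have h1 := hr (|a ^ 2 + d + 1| / |a|) (by positivity)
    have h2 : |a| * (|a ^ 2 + d + 1| / |a|) = |a ^ 2 + d + 1| := by field_simp
    have h3 := le_abs_self (a ^ 2 + d + 1)
    rcases abs_cases a with ⟨e, -⟩ | ⟨e, -⟩ <;> rw [e] at h1 h2 <;> nlinarith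
  subst ha
  have := had 0 0
  rw [had, this]
  ring

theorem eq_of_parallel (hX : IsCAT0 X) {v w w' : Geodesic X} (hw : v.Parallel w)
    (hw' : v.Parallel w') (h0 : w 0 ∈ v.crossSection) (h : w 0 = w' 0) (t : ℝ) : w t = w' t := by
  have := hX.dist_sq_of_parallel hw hw' h0 (h ▸ h0) t t
  simpa [h] using this

theorem isClosed_crossSection [ProperSpace X] (hX : IsCAT0 X) (v : Geodesic X) :
    IsClosed v.crossSection := by
  have : v.crossSection = ⋂ t, {x | dist x (v t) ^ 2 = t ^ 2 + dist x (v 0) ^ 2} := by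
    ext x
    rw [mem_iInter]
    exact ⟨fun h t => hX.dist_sq_of_mem_crossSection h t, fun h =>
      hX.mem_crossSection_of_dist_sq_le (D := dist x (v 0) ^ 2) fun t => (h t).le⟩
  rw [this]
  exact isClosed_iInter fun t => isClosed_eq (by fun_prop) (by fun_prop)

theorem segment_subset_crossSection [ProperSpace X] (hX : IsCAT0 X) (v : Geodesic X) {x y : X}
    (hx : x ∈ v.crossSection) (hy : y ∈ v.crossSection) {σ : ℝ → X}
    (hσ : IsGeodesicSegment σ x y) {r : ℝ} (hr : r ∈ Icc 0 (dist x y)) : σ r ∈ v.crossSection := by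
  rcases dist_nonneg.eq_or_lt (b := dist x y) with h | h
  · rw [← h] at hr
    rw [le_antisymm hr.2 hr.1, hσ.2.1]
    exact hx
  refine hX.mem_crossSection_of_dist_sq_le (D := dist x (v 0) ^ 2 + dist y (v 0) ^ 2) fun t => ?_
  have hs : r / dist x y ∈ Icc (0 : ℝ) 1 := ⟨by have := hr.1; positivity, (div_le_one h).2 hr.2⟩
  have := hX.dist_sq_le hσ (v t) hs
  rw [div_mul_cancel₀ _ h.ne', hX.dist_sq_of_mem_crossSection hx,
    hX.dist_sq_of_mem_crossSection hy] at this
  set l := r / dist x y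
  have h1 : 0 ≤ l * (1 - l) * dist x y ^ 2 :=
    mul_nonneg (mul_nonneg hs.1 (sub_nonneg.2 hs.2)) (sq_nonneg _)
  have h2 : 0 ≤ l * dist x (v 0) ^ 2 := mul_nonneg hs.1 (sq_nonneg _)
  have h3 : 0 ≤ (1 - l) * dist y (v 0) ^ 2 := mul_nonneg (sub_nonneg.2 hs.2) (sq_nonneg _)
  linarith

theorem subtype (hX : IsCAT0 X) {S : Set X}
    (hS : ∀ x ∈ S, ∀ y ∈ S, ∀ σ, IsGeodesicSegment σ x y → ∀ r ∈ Icc 0 (dist x y), σ r ∈ S) :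
    IsCAT0 S where
  exists_segment x y := by
    obtain ⟨σ, h1, h2, h3⟩ := hX.exists_segment x y
    have hm := hS x x.2 y y.2 σ ⟨h1, h2, h3⟩
    have : ∀ r, ∃ z : S, r ∈ Icc 0 (dist (x : X) y) → (z : X) = σ r := fun r => by
      by_cases hr : r ∈ Icc 0 (dist (x : X) y)
      exacts [⟨⟨σ r, hm r hr⟩, fun _ => rfl⟩, ⟨x, fun h => absurd h hr⟩]
    choose τ hτ using this
    refine ⟨τ, fun s hs t ht => ?_, Subtype.ext ?_, Subtype.ext ?_⟩
    · rw [Subtype.dist_eq, hτ s hs, hτ t ht]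
      exact h1 s hs t ht
    · rw [hτ 0 ⟨le_rfl, dist_nonneg⟩, h2]
    · rw [Subtype.dist_eq, hτ _ ⟨dist_nonneg, le_rfl⟩, h3]
  unique_segment x y σ τ hσ hτ t ht := Subtype.ext <|
    hX.unique_segment x y (fun t => σ t) (fun t => τ t)
      ⟨hσ.1, congrArg _ hσ.2.1, congrArg _ hσ.2.2⟩ ⟨hτ.1, congrArg _ hτ.2.1, congrArg _ hτ.2.2⟩ ht
  comparison x y z σ τ hσ hτ :=
    hX.comparison x y z (fun t => σ t) (fun t => τ t)
      ⟨hσ.1, congrArg _ hσ.2.1, congrArg _ hσ.2.2⟩ ⟨hτ.1, congrArg _ hτ.2.1, congrArg _ hτ.2.2⟩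

theorem crossSection [ProperSpace X] (hX : IsCAT0 X) (v : Geodesic X) : IsCAT0 v.crossSection :=
  hX.subtype fun _ hx _ hy _ hσ _ hr => hX.segment_subset_crossSection v hx hy hσ hr

/-- A space that is the parallel set of `v` splits as `C_v × v`. -/
theorem exists_isometryEquiv_prod [ProperSpace X] (hX : IsCAT0 X) (v : Geodesic X)
    (hv : ∀ x, x ∈ v.parallelSet) :
    ∃ (e : v.crossSection) (φ : X ≃ᵢ WithLp 2 (v.crossSection × ℝ)),
      ∀ t, φ (v t) = WithLp.toLp 2 (e, t) := by
  choose L hL0 hLp using fun x : v.crossSection => hX.exists_parallel_of_mem_crossSection x.2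
  have hmem : ∀ x, L x 0 ∈ v.crossSection := fun x => by rw [hL0]; exact x.2
  let ψ : WithLp 2 (v.crossSection × ℝ) → X := fun p => L p.fst p.snd
  have hψ : Isometry ψ := Isometry.of_dist_eq fun p q => by
    rw [WithLp.prod_dist_eq_add (by norm_num)]
    have := hX.dist_sq_of_parallel (hLp p.fst) (hLp q.fst) (hmem _) (hmem _) p.snd q.snd
    rw [hL0, hL0, ← Subtype.dist_eq, ← sq_abs (p.snd - q.snd), ← Real.dist_eq] at this
    rw [ENNReal.toReal_ofNat, ← Real.sqrt_eq_rpow, Real.rpow_two, Real.rpow_two, add_comm, ← this,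
      Real.sqrt_sq dist_nonneg]
  have hsurj : Function.Surjective ψ := fun x => by
    obtain ⟨w, h0, hp, a, rfl⟩ := hX.exists_parallel_of_mem_parallelSet (hv x)
    exact ⟨WithLp.toLp 2 (⟨w 0, h0⟩, a), hX.eq_of_parallel (hLp _) hp (hmem _) (hL0 _) a⟩
  refine ⟨⟨v 0, hX.self_mem_crossSection v⟩,
    (IsometryEquiv.mk (Equiv.ofBijective ψ ⟨hψ.injective, hsurj⟩) hψ).symm, fun t => ?_⟩
  rw [IsometryEquiv.symm_apply_eq]
  exact (hX.eq_of_parallel (hLp _) ⟨0, fun t => dist_self _⟩ (hmem _) (hL0 _) t).symm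

/-! ### Lines in the flat u × v. -/

/-- Coordinates on the flat `u × v ⊆ C_v × v`. -/
theorem exists_flat [ProperSpace X] (hX : IsCAT0 X) {v : Geodesic X} (u : Geodesic v.crossSection)
    (hu : (u 0 : X) = v 0) :
    ∃ F : ℝ → ℝ → X, (∀ s, F s 0 = u s) ∧ (∀ t, F 0 t = v t) ∧
      (∀ s t s' t', dist (F s t) (F s' t') ^ 2 = (s - s') ^ 2 + (t - t') ^ 2) ∧
      (∀ x ∈ v.crossSection, ∀ s t, dist x (F s t) ^ 2 = t ^ 2 + dist x (u s) ^ 2) ∧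
      ∀ z ∈ v.prodSet (range fun s => (u s : X)), ∃ s t, z = F s t := by
  choose L hL0 hLp using fun s => hX.exists_parallel_of_mem_crossSection (u s).2
  have hmem : ∀ s, L s 0 ∈ v.crossSection := fun s => by rw [hL0]; exact (u s).2
  refine ⟨fun s => L s, hL0, fun t => ?_, fun s t s' t' => ?_, fun x hx s t => ?_, ?_⟩
  · exact hX.eq_of_parallel (hLp 0) ⟨0, fun t => dist_self _⟩ (hmem 0) (by rw [hL0, hu]) t
  · rw [hX.dist_sq_of_parallel (hLp s) (hLp s') (hmem s) (hmem s'), hL0, hL0, ← Subtype.dist_eq,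
      u.dist_apply, sq_abs, add_comm]
  · obtain ⟨w, rfl, hw⟩ := hX.exists_parallel_of_mem_crossSection hx
    rw [hX.dist_sq_of_parallel hw (hLp s) hx (hmem s), hL0]
    ring
  · rintro z ⟨hz, _, ⟨s, rfl⟩, -, ⟨-, hmin⟩, -⟩
    obtain ⟨w, h0, hp, a, rfl⟩ := hX.exists_parallel_of_mem_parallelSet hz
    have h1 := hmin (w 0) h0
    have h2 := hX.dist_sq_of_parallel hp (hLp s) h0 (hmem s) a 0
    beta_reduce at h1
    rw [hL0] at h2
    rw [← sq_le_sq₀ dist_nonneg dist_nonneg, h2, w.dist_apply, sq_abs] at h1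
    -- The nearest point u(s) is no farther than w 0, which is at distance |a|; Pythagoras leaves no
    -- room between them.
    have h3 : w 0 = L s 0 := by
      rw [hL0, ← dist_eq_zero, ← sq_eq_zero_iff]
      refine le_antisymm ?_ (sq_nonneg _)
      linarith
    exact ⟨s, a, hX.eq_of_parallel hp (hLp s) h0 h3 a⟩

/-- In coordinates γ is an isometric embedding of ℝ into ℂ, hence affine by strict convexity. -/
theorem exists_affine_coordinates {F : ℝ → ℝ → X}
    (hF : ∀ s t s' t', dist (F s t) (F s' t') ^ 2 = (s - s') ^ 2 + (t - t') ^ 2)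
    {γ : Geodesic X} (hγ : ∀ r, ∃ s t, γ r = F s t) :
    ∃ a b c d : ℝ, b ^ 2 + d ^ 2 = 1 ∧ ∀ r, γ r = F (a + b * r) (c + d * r) := by
  choose S A hSA using hγ
  have hZ : Isometry fun r => (⟨S r, A r⟩ : ℂ) := Isometry.of_dist_eq fun r r' => by
    rw [← γ.2.dist_eq]
    rw [Complex.dist_eq_re_im, ← hF, Real.sqrt_sq dist_nonneg, hSA, hSA]
  have hlin : ∀ r, (⟨S r, A r⟩ : ℂ) = r • ((⟨S 1, A 1⟩ : ℂ) - ⟨S 0, A 0⟩) + ⟨S 0, A 0⟩ := fun r => by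
    have := hZ.affineIsometryOfStrictConvexSpace.toAffineMap.apply_lineMap 0 1 r
    simpa [AffineMap.lineMap_apply] using this
  refine ⟨S 0, S 1 - S 0, A 0, A 1 - A 0, ?_, fun r => ?_⟩
  · rw [← hF, ← hSA, ← hSA, γ.dist_apply]; norm_num
  · have h1 := congrArg Complex.re (hlin r)
    have h2 := congrArg Complex.im (hlin r)
    simp at h1 h2
    rw [hSA, h1, h2]
    congr 1 <;> ring

theorem isometry_line {F : ℝ → ℝ → X}
    (hF : ∀ s t s' t', dist (F s t) (F s' t') ^ 2 = (s - s') ^ 2 + (t - t') ^ 2)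
    {b d : ℝ} (h : b ^ 2 + d ^ 2 = 1) (p q : ℝ) : Isometry fun r => F (p + b * r) (q + d * r) :=
  Isometry.of_dist_eq fun r r' => by
    rw [Real.dist_eq, ← sq_eq_sq₀ dist_nonneg (abs_nonneg _), hF, sq_abs]
    linear_combination (r - r') ^ 2 * h

/-- Here α runs along γ and β along the normal (d, -b). The line of fixed β is parallel to γ and
starts in the cross section of γ, so the splitting of the parallel set of γ applies. -/
theorem dist_sq_line_of_mem_crossSection [ProperSpace X] (hX : IsCAT0 X) {F : ℝ → ℝ → X}
    (hF : ∀ s t s' t', dist (F s t) (F s' t') ^ 2 = (s - s') ^ 2 + (t - t') ^ 2)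
    {γ : Geodesic X} {a b c d : ℝ} (h : b ^ 2 + d ^ 2 = 1)
    (hγ : ∀ r, γ r = F (a + b * r) (c + d * r)) {y : X} (hy : y ∈ γ.crossSection) (α β : ℝ) :
    dist y (F (a + d * β + b * α) (c - b * β + d * α)) ^ 2 =
      α ^ 2 + dist y (F (a + d * β) (c - b * β)) ^ 2 := by
  obtain ⟨w, rfl, hw⟩ := hX.exists_parallel_of_mem_crossSection hy
  set l := ofIsometry _ (isometry_line hF h (a + d * β) (c - b * β)) with hl
  have hd : ∀ s t, dist (l s) (γ t) ^ 2 = (t - s) ^ 2 + β ^ 2 := fun s t => by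
    rw [hγ, hl, ofIsometry_apply, hF]
    linear_combination ((t - s) ^ 2 + β ^ 2) * h
  have hlp := (hX.parallel_of_dist_sq fun s t => (hd s t).le).1
  have hl0 : l 0 ∈ γ.crossSection :=
    hX.mem_crossSection_of_dist_sq_le (D := β ^ 2) fun t => by simpa using (hd 0 t).le
  have := hX.dist_sq_of_parallel hw hlp hy hl0 0 α
  simpa [hl] using this

/-! ### The opposite inequality. -/

/-- Each step of length r costs r² + d(x, y)² by the quadrilateral inequality, wherever on w it is
taken. Cutting a fixed length T into N steps makes the r² part total T²/N. -/
theorem dist_sq_sub_le (hX : IsCAT0 X) (w : Geodesic X) (x y : X) (s r : ℝ) (N : ℕ) :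
    (dist (w (s + N * r)) x ^ 2 - dist (w (s + N * r)) y ^ 2) -
      (dist (w s) x ^ 2 - dist (w s) y ^ 2) ≤ N * (r ^ 2 + dist x y ^ 2) := by
  induction N with
  | zero => simp
  | succ N ih =>
    have h := hX.quadrilateral (w (s + N * r)) (w (s + (N + 1) * r)) y x
    rw [w.dist_apply, sq_abs, dist_comm x, dist_comm y x] at h
    push_cast
    linarith

theorem dist_sq_add_dist_sq_le [ProperSpace X] (hX : IsCAT0 X) {v : Geodesic X}
    {u : Geodesic v.crossSection} (hu : (u 0 : X) = v 0) {vn : ℕ → Geodesic X}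
    (hlim : Tendsto vn atTop (𝓝 v))
    (hflat : ∀ n t, vn n t ∈ v.prodSet (range fun s => (u s : X)))
    (hpar : ∀ n, ¬ v.Parallel (vn n)) {x : X} (hx : x ∈ v.crossSection) {xn : ℕ → X}
    (hxn : ∀ n, xn n ∈ (vn n).crossSection) (hxx : Tendsto xn atTop (𝓝 x)) (s T : ℝ) :
    dist x (u (s + T)) ^ 2 + dist x (u (s - T)) ^ 2 ≤ 2 * dist x (u s) ^ 2 + 2 * T ^ 2 := by
  obtain ⟨F, hFu, hFv, hF, hFx, hFz⟩ := hX.exists_flat u hu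
  choose a b c d hbd hvn using fun n =>
    exists_affine_coordinates hF (γ := vn n) fun r => hFz _ (hflat n r)
  have hpt : ∀ r, Tendsto (fun n => dist (vn n r) (v r) ^ 2) atTop (𝓝 0) := by
    intro r
    have h1 : Tendsto (fun n => vn n r) atTop (𝓝 (v r)) :=
      (((continuous_eval_const r).comp continuous_subtype_val).tendsto v).comp hlim
    have h2 := (h1.dist (tendsto_const_nhds (x := v r))).pow 2
    simpa using h2
  have hto : ∀ {f : ℕ → ℝ} {r : ℝ}, (∀ n, f n ^ 2 ≤ dist (vn n r) (v r) ^ 2) →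
      Tendsto f atTop (𝓝 0) := fun {f r} h => by
    have h1 := squeeze_zero (fun n => sq_nonneg (f n)) h (hpt r)
    have h2 := h1.sqrt
    simp only [Real.sqrt_sq_eq_abs, Real.sqrt_zero] at h2
    exact (tendsto_zero_iff_abs_tendsto_zero _).2 h2
  have ha : Tendsto a atTop (𝓝 0) := hto (r := 0) fun n => by
    rw [hvn, ← hFv, hF]; nlinarith [sq_nonneg (c n)]
  have hc : Tendsto c atTop (𝓝 0) := hto (r := 0) fun n => by
    rw [hvn, ← hFv, hF]; nlinarith [sq_nonneg (a n)]
  have hb : Tendsto b atTop (𝓝 0) := by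
    have : Tendsto (fun n => a n + b n) atTop (𝓝 0) := hto (r := 1) fun n => by
      rw [hvn, ← hFv, hF]; nlinarith [sq_nonneg (c n + d n - 1)]
    simpa using this.sub ha
  have hd : Tendsto d atTop (𝓝 1) := by
    have : Tendsto (fun n => c n + d n - 1) atTop (𝓝 0) := hto (r := 1) fun n => by
      rw [hvn, ← hFv, hF]; nlinarith [sq_nonneg (a n + b n)]
    convert (this.sub hc).add_const 1 using 2 <;> ring
  -- If b n = 0 and d n > 0, then d n = 1 and v_n is a vertical line, parallel to v.
  have hb0 : ∀ᶠ n in atTop, b n ≠ 0 := by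
    filter_upwards [hd.eventually (lt_mem_nhds zero_lt_one)] with n hn hbn
    have hd1 : d n = 1 := by
      have := hbd n
      rw [hbn] at this
      nlinarith
    refine hpar n ⟨√(a n ^ 2 + c n ^ 2), fun t => ?_⟩
    rw [eq_comm, Real.sqrt_eq_iff_eq_sq (by positivity) dist_nonneg, ← hFv, hvn, hF, hbn, hd1]
    ring
  have hFc : ∀ {p q : ℕ → ℝ} {p' q' : ℝ}, Tendsto p atTop (𝓝 p') → Tendsto q atTop (𝓝 q') →
      Tendsto (fun n => F (p n) (q n)) atTop (𝓝 (F p' q')) := by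
    intro p q p' q' hp hq
    have h1 := (((hp.sub_const p').pow 2).add ((hq.sub_const q').pow 2)).sqrt
    rw [tendsto_iff_dist_tendsto_zero]
    simpa [← hF, Real.sqrt_sq dist_nonneg] using h1
  -- Let n → ∞ with N fixed, so that N d(x, x_n)² vanishes; only afterwards N → ∞.
  have hN : ∀ N : ℕ, 0 < N → dist x (u (s + T)) ^ 2 - dist x (u s) ^ 2 - 2 * T ^ 2 +
      dist x (u (s - T)) ^ 2 - dist x (u s) ^ 2 ≤ T ^ 2 / N := by
    intro N hN
    have hN' : (N : ℝ) ≠ 0 := by positivity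
    have key : ∀ᶠ n in atTop, dist x (u (s + T)) ^ 2 - dist x (u s) ^ 2 -
        2 * T * (s - a n - s * d n + T * d n ^ 2) - T ^ 2 * b n ^ 2 +
        dist (xn n) (F (a n + d n * (s - T * d n)) (c n - b n * (s - T * d n))) ^ 2 -
        dist (xn n) (F (a n + d n * s) (c n - b n * s)) ^ 2 ≤
        N * ((T / N) ^ 2 + dist x (xn n) ^ 2) := by
      filter_upwards [hb0] with n hn
      -- α places the tilted line β = s - T d_n at horizontal coordinate s, at height h. A
      -- horizontal move by T adds (T b_n, T d_n) to (α, β), so F(s + T, h) lies on the line β = s.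
      set α := (s - a n - d n * (s - T * d n)) / b n with hα
      have hαb : b n * α = s - a n - d n * (s - T * d n) := by rw [hα]; field_simp
      have h1 := hX.dist_sq_line_of_mem_crossSection hF (hbd n) (hvn n) (hxn n) α (s - T * d n)
      have h2 := hX.dist_sq_line_of_mem_crossSection hF (hbd n) (hvn n) (hxn n) (α + T * b n) s
      set h := c n - b n * (s - T * d n) + d n * α with hh
      rw [show a n + d n * (s - T * d n) + b n * α = s by linarith] at h1
      rw [show a n + d n * s + b n * (α + T * b n) = s + T by
          linear_combination hαb + T * hbd n,
        show c n - b n * s + d n * (α + T * b n) = h by rw [hh]; ring] at h2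
      have h3 := hX.dist_sq_sub_le
        (ofIsometry _ (isometry_line hF (b := 1) (d := 0) (by norm_num) 0 h)) x (xn n) s (T / N) N
      simp only [ofIsometry_apply, zero_add, one_mul, zero_mul, add_zero,
        mul_div_cancel₀ _ hN'] at h3
      rw [dist_comm _ x, dist_comm _ x, dist_comm _ (xn n), dist_comm _ (xn n), hFx x hx,
        hFx x hx, h1, h2] at h3
      linear_combination h3 + 2 * T * hαb
    have hl1 : Tendsto (fun n => dist x (u (s + T)) ^ 2 - dist x (u s) ^ 2 -
        2 * T * (s - a n - s * d n + T * d n ^ 2) - T ^ 2 * b n ^ 2 +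
        dist (xn n) (F (a n + d n * (s - T * d n)) (c n - b n * (s - T * d n))) ^ 2 -
        dist (xn n) (F (a n + d n * s) (c n - b n * s)) ^ 2) atTop
        (𝓝 (dist x (u (s + T)) ^ 2 - dist x (u s) ^ 2 -
        2 * T * (s - 0 - s * 1 + T * 1 ^ 2) - T ^ 2 * 0 ^ 2 +
        dist x (F (0 + 1 * (s - T * 1)) (0 - 0 * (s - T * 1))) ^ 2 -
        dist x (F (0 + 1 * s) (0 - 0 * s)) ^ 2)) := by
      have hβ := (hd.const_mul T).const_sub s
      refine ((((tendsto_const_nhds.sub ((((ha.const_sub s).sub (hd.const_mul s)).add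
        ((hd.pow 2).const_mul T)).const_mul (2 * T))).sub ((hb.pow 2).const_mul _)).add
        ((hxx.dist (hFc (ha.add (hd.mul hβ)) (hc.sub (hb.mul hβ)))).pow 2)).sub
        ((hxx.dist (hFc (ha.add (hd.mul_const s)) (hc.sub (hb.mul_const s)))).pow 2))
    have hl2 : Tendsto (fun n => N * ((T / N) ^ 2 + dist x (xn n) ^ 2)) atTop
        (𝓝 (N * ((T / N) ^ 2 + dist x x ^ 2))) :=
      (((tendsto_const_nhds.dist hxx).pow 2).const_add _).const_mul _
    have h := le_of_tendsto_of_tendsto hl1 hl2 key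
    have e1 : N * ((T / N) ^ 2 + dist x x ^ 2) = T ^ 2 / N := by
      rw [dist_self]; field_simp; ring
    rw [e1] at h
    simp only [zero_add, one_mul, mul_one, zero_mul, sub_zero, hFu] at h
    linarith
  have hz : Tendsto (fun N : ℕ => T ^ 2 / (N : ℝ)) atTop (𝓝 0) :=
    tendsto_const_div_atTop_nhds_zero_nat _
  have := ge_of_tendsto hz ((eventually_gt_atTop 0).mono hN)
  linarith

/-- With Bruhat–Tits the hypothesis becomes an equality, so d(x, u(s))² - s² is affine; its slope k
puts the foot at -k/2. -/
theorem mem_parallelSet_of_dist_sq_add_le [ProperSpace X] (hX : IsCAT0 X) {u : Geodesic X} {x : X}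
    (h : ∀ s T, dist x (u (s + T)) ^ 2 + dist x (u (s - T)) ^ 2 ≤
      2 * dist x (u s) ^ 2 + 2 * T ^ 2) : x ∈ u.parallelSet := by
  obtain ⟨k, hk⟩ := eq_linear_of_midpoint_affine (f := fun s => dist x (u s) ^ 2 - s ^ 2)
    (by have := u.continuous; fun_prop) fun s T => by
      have h1 := h s T
      have h2 := hX.two_mul_dist_sq_le u x s T
      linarith
  refine hX.mem_parallelSet_of_dist_sq_le (a := -(k / 2)) (D := dist x (u 0) ^ 2) fun t => ?_
  have := hk t
  beta_reduce at this
  nlinarith [sq_nonneg k]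

end IsCAT0

/-! ### The decomposition lemma. -/

theorem mainTheorem7 {X : Type uX} [MetricSpace X] [ProperSpace X]
    (hX : IsCAT0 X) (hgc : GeodesicallyComplete X)
    (v : Geodesic X) (u : Geodesic v.crossSection) (hu : (u 0 : X) = v 0)
    (vn : ℕ → Geodesic X) (hlim : Tendsto vn atTop (𝓝 v))
    (hflat : ∀ n t, vn n t ∈ v.prodSet (range fun s => (u s : X)))
    (hpar : ∀ n, ¬ v.Parallel (vn n))
    (happ : ∀ x ∈ v.crossSection, ∃ xn : ℕ → X,
      (∀ n, xn n ∈ (vn n).crossSection) ∧ Tendsto xn atTop (𝓝 x)) :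
    v.crossSection = Subtype.val '' u.parallelSet ∧
    ∃ (E : Type uX) (_ : MetricSpace E), ProperSpace E ∧ IsCAT0 E ∧
      ∃ (e : E) (φ : v.crossSection ≃ᵢ WithLp 2 (E × ℝ)),
        ∀ t : ℝ, φ (u t) = WithLp.toLp 2 (e, t) := by
  have : ProperSpace v.crossSection := .of_isClosed (hX.isClosed_crossSection v)
  have hC := hX.crossSection v
  have hP : ∀ x, x ∈ u.parallelSet := fun x => hC.mem_parallelSet_of_dist_sq_add_le fun s T => by
    obtain ⟨xn, hxn, hxx⟩ := happ x x.2
    exact hX.dist_sq_add_dist_sq_le hu hlim hflat hpar x.2 hxn hxx s T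
  refine ⟨?_, u.crossSection, inferInstance, .of_isClosed (hC.isClosed_crossSection u),
    hC.crossSection u, hC.exists_isometryEquiv_prod u hP⟩
  rw [eq_univ_of_forall hP, image_univ, Subtype.range_coe]
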